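/- Fix a set $E$ of events and a set $R$ of return values. Interaction trees (ITrees) over $(E,R)$ form the codatatype (final coalgebra) with three constructors: $\mathsf{Ret}\,x$ for $x\in R$; $\tau P$ for an ITree $P$; and $\mathsf{Vis}\,F$ for a partial function $F$ from $E$ to ITrees. Let $\mathsf{stop}=\mathsf{Vis}\,\emptyset$ and let $\mathsf{div}$ be the ITree defined corecursively by $\mathsf{div}=\tau\,\mathsf{div}$. An ITree is stable if it is not of the form $\tau P'$; $P$ is divergent, written $P\Uparrow$, if there are no $n\in\mathbb N$ and stable $P'$ with $P=\tau^nP'$. Weak bisimilarity. For a relation $\mathcal R$ on ITrees, let $\approx_{\mathcal R}$ be the least relation such that $\mathsf{Ret}\,x\approx_{\mathcal R}\mathsf{Ret}\,x$; if $P\approx_{\mathcal R}Q$ then $\tau P\approx_{\mathcal R}Q$ and $P\approx_{\mathcal R}\tau Q$; and $\mathsf{Vis}\,F\approx_{\mathcal R}\mathsf{Vis}\,G$ whenever $\mathrm{dom}\,F=\mathrm{dom}\,G$ and $\mathcal R(F(e),G(e))$ for all $e\in\mathrm{dom}\,F$. Then $\approx$ is the union of all relations $\mathcal R$ with $\mathcal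 R\subseteq\{(\mathsf{div},\mathsf{div})\}\cup(\approx_{\mathcal R})$. Traces and divergences. Let $P\xrightarrow{t}P'$ ($t$ a finite list over $E$) be the least relation such that $P\xrightarrow{[]}P$; if $P\xrightarrow{t}P'$ then $\tau P\xrightarrow{t}P'$; and if $e\in\mathrm{dom}\,F$ and $F(e)\xrightarrow{t}P'$ then $\mathsf{Vis}\,F\xrightarrow{e\,::\,t}P'$. Let $\Sigma=E$ and let $\Sigma^\checkmark=\Sigma\sqcup\{\checkmark_x : x\in R\}$ be the events together with a separate termination event for each return value. For a finite list $s$ over $\Sigma^\checkmark$, Roscoe's step relation $P\stackrel{s}{\Rightarrow}P'$ holds iff either there are a list $t$ over $\Sigma$ and $x\in R$ with $s=t\mathbin{+\!\!+}[\checkmark_x]$, $P\xrightarrow{t}\mathsf{Ret}\,x$ and $P'=\mathsf{stop}$; or $s$ is a list over $\Sigma$ and $P\xrightarrow{s}P'$. Define $$\mathsf{traces}(P)=\{s\in(\Sigma^\checkmark)^* : \exists P'.\ P\stackrel{s}{\Rightarrow}P'\},$$ $$\mathsf{divergences}(P)=\{s\mathbin{+\!\!+}t : s,t\in\Sigma^*,\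 \exists Q.\ P\stackrel{s}{\Rightarrow}Q\wedge Q\Uparrow\}.$$ Theorem. For all ITrees $P,Q$ over $(E,R)$, $$P\approx Q\iff\mathsf{traces}(P)=\mathsf{traces}(Q)\ \wedge\ \mathsf{divergences}(P)=\mathsf{divergences}(Q).$$ -/

import Mathlib

/-- The three kinds of node of an interaction tree with events in `E` and return values in `R`:
a return of a value, a silent step, or a visible choice between the events of a set. -/
inductive ITreeShape (E : Type*) (R : Type*) where
  | ret (r : R)
  | sil
  | vis (D : Set E)

/-- The polynomial functor `X ↦ R + X + (E ⇸ X)`: a return has no child, a silent step has one,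
and a visible choice over `D` has one child for each event of `D`. -/
def itreeFunctor (E : Type*) (R : Type*) : PFunctor where
  A := ITreeShape E R
  B := fun a => match a with
    | .ret _ => PEmpty
    | .sil => PUnit
    | .vis D => D

/-- Interaction trees: the final coalgebra (codatatype) with constructors
`Ret r`, `Sil P` (written `τ P`) and `Vis F`, where `F` is a partial function from events to
interaction trees. -/
def ITree (E : Type*) (R : Type*) := PFunctor.M (itreeFunctor E R)

namespace ITree

/-- `Ret r`: termination, returning `r`. -/
def ret {E R : Type*} (r : R) : ITree E R :=
  PFunctor.M.mk (F := itreeFunctor E R) ⟨.ret r, PEmpty.elim⟩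

/-- `Sil P = τ P`: a silent event, after which `P` follows. -/
def sil {E R : Type*} (P : ITree E R) : ITree E R :=
  PFunctor.M.mk (F := itreeFunctor E R) ⟨.sil, fun _ => P⟩

/-- `Vis F`: a choice between the visible events `e ∈ dom F`, with continuations `F e`. -/
def vis {E R : Type*} (F : E →. ITree E R) : ITree E R :=
  PFunctor.M.mk (F := itreeFunctor E R) ⟨.vis F.Dom, fun e => F.fn e.1 e.2⟩

/-- The deadlocked tree, also known as STOP: the visible choice over the empty partial function. -/
def deadlock {E R : Type*} : ITree E R :=
  vis fun _ => Part.none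

/-- The divergent tree, defined corecursively by `div = τ div`. -/
def div {E R : Type*} : ITree E R :=
  PFunctor.M.corec (F := itreeFunctor E R) (fun _ : PUnit => ⟨.sil, fun x => x⟩) PUnit.unit

theorem div_eq_sil_div {E R : Type*} : (div : ITree E R) = sil div :=
  PFunctor.M.corec_def (F := itreeFunctor E R) (fun _ : PUnit => ⟨ITreeShape.sil, fun x => x⟩) PUnit.unit

/-- A tree is stable if it does not have the form `τ P'`. -/
def Stable {E R : Type*} (P : ITree E R) : Prop :=
  ¬ ∃ P', P = sil P'

/-- A tree stabilises if it becomes stable after finitely many silent events. -/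
def Stabilises {E R : Type*} (P : ITree E R) : Prop :=
  ∃ (n : ℕ) (P' : ITree E R), P = sil^[n] P' ∧ Stable P'

/-- A tree is divergent if it does not stabilise. -/
def Divergent {E R : Type*} (P : ITree E R) : Prop :=
  ¬ Stabilises P

/-- Big-step operational semantics: `Trans P tr P'` means that `P` can perform the list `tr` of
visible events, skipping over silent events, and evolve to `P'`. -/
inductive Trans {E R : Type*} : ITree E R → List E → ITree E R → Prop
  | refl (P : ITree E R) : Trans P [] P
  | sil {P P' : ITree E R} {tr : List E} : Trans P tr P' → Trans (sil P) tr P'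
  | vis {F : E →. ITree E R} {e : E} {Q P' : ITree E R} {tr : List E} :
      Q ∈ F e → Trans Q tr P' → Trans (vis F) (e :: tr) P'

/-- The inductive relation `≈_𝓡`: after finitely many silent events on either side, both trees
return the same value, or both offer a choice over the same events, with continuations related
by `𝓡`. -/
inductive WeakBisimStep {E R : Type*} (𝓡 : ITree E R → ITree E R → Prop) :
    ITree E R → ITree E R → Prop
  | ret (x : R) : WeakBisimStep 𝓡 (ret x) (ret x)
  | sil_left {P Q : ITree E R} : WeakBisimStep 𝓡 P Q → WeakBisimStep 𝓡 (sil P) Q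
  | sil_right {P Q : ITree E R} : WeakBisimStep 𝓡 P Q → WeakBisimStep 𝓡 P (sil Q)
  | vis {F G : E →. ITree E R} : F.Dom = G.Dom →
      (∀ e, ∀ P ∈ F e, ∀ Q ∈ G e, 𝓡 P Q) → WeakBisimStep 𝓡 (vis F) (vis G)

/-- Weak bisimilarity `P ≈ Q`: the union of all relations `𝓡 ⊆ {(div, div)} ∪ (≈_𝓡)`. -/
def WeakBisim {E R : Type*} (P Q : ITree E R) : Prop :=
  ∃ 𝓡 : ITree E R → ITree E R → Prop,
    (∀ P' Q', 𝓡 P' Q' → (P' = div ∧ Q' = div) ∨ WeakBisimStep 𝓡 P' Q') ∧ 𝓡 P Q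

/-- Events extended with a family of termination events `✓x`, one for each return value `x`. -/
inductive TickEvent (E : Type*) (R : Type*) where
  | ev (e : E)
  | tick (x : R)

/-- `Σ`: the ordinary events, as a set of extended events. -/
def ordinaryEvents (E R : Type*) : Set (TickEvent E R) :=
  Set.range TickEvent.ev

/-- `Σ^✓ = Σ ∪ {✓x | x}`. -/
def allEvents (E R : Type*) : Set (TickEvent E R) :=
  ordinaryEvents E R ∪ Set.range TickEvent.tick

/-- Roscoe's step relation `P ⇒[s] P'`: either `s` is a list of ordinary events followed by a
termination event `✓x`, `P` reaches `Ret x` by performing these events, and `P' = deadlock`; or `s`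
consists of ordinary events only, and `P` can perform them and evolve to `P'`. -/
def RoscoeStep {E R : Type*} (P : ITree E R) (s : List (TickEvent E R)) (P' : ITree E R) : Prop :=
  (∃ (t : List E) (x : R), s = t.map TickEvent.ev ++ [TickEvent.tick x] ∧
      Trans P t (ret x) ∧ P' = deadlock) ∨
    ∃ t : List E, s = t.map TickEvent.ev ∧ Trans P t P'

/-- The traces of `P`. -/
def traces {E R : Type*} (P : ITree E R) : Set (List (TickEvent E R)) :=
  {s | (∀ a ∈ s, a ∈ allEvents E R) ∧ ∃ P', RoscoeStep P s P'}

/-- The divergences of `P`: the lists of ordinary events that lead to a divergent tree, followed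
by arbitrary ordinary events. -/
def divergences {E R : Type*} (P : ITree E R) : Set (List (TickEvent E R)) :=
  {r | ∃ s t : List (TickEvent E R), r = s ++ t ∧
    (∀ a ∈ s, a ∈ ordinaryEvents E R) ∧ (∀ a ∈ t, a ∈ ordinaryEvents E R) ∧
    ∃ Q, RoscoeStep P s Q ∧ Divergent Q}

end ITree

/-! Interaction trees are deterministic: after a visible event the continuation is unique, so traces
and divergences of a choice split, event by event, into those of its continuations. Both sets also
ignore silent steps. Soundness is therefore an induction on finite lists
(`WeakBisim.eq_of_recursive`). For completeness, equality of both sets is itself a weak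
bisimulation: the empty list detects divergence, and `div` is the only divergent tree
(`Divergent.eq_div`); otherwise both trees stabilise, and traces of length one fix the head
constructor (`TraceDivergenceEq.weakBisimStep_of_stable`). -/

namespace ITree

/-! ### Constructors: injectivity, disjointness, exhaustiveness. -/

variable {E R : Type*}

/-- `VisChild P e Q` says that `P` is a visible choice which continues as `Q` after `e`. -/
def VisChild (P : ITree E R) (e : E) (Q : ITree E R) : Prop :=
  match PFunctor.M.dest (F := itreeFunctor E R) P with
  | ⟨.vis D, f⟩ => ∃ h : e ∈ D, f ⟨e, h⟩ = Q
  | _ => False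

theorem visChild_vis {F : E →. ITree E R} {e : E} {Q : ITree E R} :
    VisChild (vis F) e Q ↔ Q ∈ F e :=
  Iff.rfl

/-- Comparing through `VisChild` avoids heterogeneous equality between continuation maps over
different domains. -/
theorem vis_injective {F G : E →. ITree E R} (h : vis F = vis G) : F = G := by
  funext e
  ext Q
  rw [← visChild_vis, ← visChild_vis, h]

theorem sil_injective : Function.Injective (sil : ITree E R → ITree E R) := by
  intro P Q h
  have h' := PFunctor.M.mk_inj (F := itreeFunctor E R) h
  exact congrFun (eq_of_heq (Sigma.mk.inj h').2) PUnit.unit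

theorem ret_injective : Function.Injective (ret : R → ITree E R) := by
  intro x y h
  have h' := PFunctor.M.mk_inj (F := itreeFunctor E R) h
  exact ITreeShape.ret.inj (Sigma.mk.inj h').1

theorem ret_ne_sil {x : R} {P : ITree E R} : ret x ≠ sil P := by
  intro h
  have h' := PFunctor.M.mk_inj (F := itreeFunctor E R) h
  exact ITreeShape.noConfusion rfl rfl (heq_of_eq (Sigma.mk.inj h').1)

theorem ret_ne_vis {x : R} {F : E →. ITree E R} : ret x ≠ vis F := by
  intro h
  have h' := PFunctor.M.mk_inj (F := itreeFunctor E R) h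
  exact ITreeShape.noConfusion rfl rfl (heq_of_eq (Sigma.mk.inj h').1)

theorem sil_ne_vis {P : ITree E R} {F : E →. ITree E R} : sil P ≠ vis F := by
  intro h
  have h' := PFunctor.M.mk_inj (F := itreeFunctor E R) h
  exact ITreeShape.noConfusion rfl rfl (heq_of_eq (Sigma.mk.inj h').1)

theorem eq_ret_or_sil_or_vis (P : ITree E R) :
    (∃ x, P = ret x) ∨ (∃ Q, P = sil Q) ∨ ∃ F, P = vis F := by
  have hP := PFunctor.M.mk_dest (F := itreeFunctor E R) P
  revert hP
  generalize PFunctor.M.dest (F := itreeFunctor E R) P = d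
  rintro rfl
  rcases d with ⟨a, f⟩
  rcases a with x | _ | D
  · refine Or.inl ⟨x, ?_⟩
    have hf : f = PEmpty.elim := by
      funext y
      exact PEmpty.elim y
    rw [hf]
    rfl
  · exact Or.inr (Or.inl ⟨f PUnit.unit, rfl⟩)
  · exact Or.inr (Or.inr ⟨fun e => ⟨e ∈ D, fun h => f ⟨e, h⟩⟩, rfl⟩)

/-! ### Stability and divergence. -/

theorem stable_vis (F : E →. ITree E R) : Stable (vis F) :=
  fun ⟨_, h⟩ => sil_ne_vis h.symm

theorem Stable.eq_ret_or_vis {P : ITree E R} (h : Stable P) :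
    (∃ x, P = ret x) ∨ ∃ F, P = vis F := by
  rcases eq_ret_or_sil_or_vis P with hx | hs | hF
  · exact Or.inl hx
  · exact absurd hs h
  · exact Or.inr hF

theorem Stable.not_divergent {P : ITree E R} (h : Stable P) : ¬ Divergent P :=
  fun hd => hd ⟨0, P, rfl, h⟩

theorem divergent_sil {P : ITree E R} : Divergent (sil P) ↔ Divergent P := by
  refine not_congr ⟨?_, ?_⟩
  · rintro ⟨n, P', h, hs⟩
    cases n with
    | zero => exact absurd ⟨P, h.symm⟩ hs
    | succ n =>
      rw [Function.iterate_succ_apply'] at h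
      exact ⟨n, P', sil_injective h, hs⟩
  · rintro ⟨n, P', rfl, hs⟩
    exact ⟨n + 1, P', (Function.iterate_succ_apply' _ _ _).symm, hs⟩

theorem Divergent.exists_eq_sil {P : ITree E R} (h : Divergent P) :
    ∃ Q, P = sil Q ∧ Divergent Q := by
  by_cases hs : ∃ Q, P = sil Q
  · obtain ⟨Q, rfl⟩ := hs
    exact ⟨Q, rfl, divergent_sil.1 h⟩
  · exact absurd h (Stable.not_divergent hs)

/-- A divergent tree is a silent step before another divergent tree, so relating every divergent
tree to `div` is a strong bisimulation. -/
theorem Divergent.eq_div {P : ITree E R} (h : Divergent P) : P = div := by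
  refine PFunctor.M.bisim (P := itreeFunctor E R) (fun X Y => Divergent X ∧ Y = div) ?_ P div ⟨h, rfl⟩
  rintro X _ ⟨hX, rfl⟩
  obtain ⟨X', rfl, hX'⟩ := hX.exists_eq_sil
  refine ⟨.sil, fun _ => X', fun _ => div, rfl, ?_, fun _ => ⟨hX', rfl⟩⟩
  -- Only the left side is unfolded; the `div` on the right is the child.
  conv_lhs => rw [div_eq_sil_div]
  rfl

/-! ### Transitions from each constructor. -/

theorem trans_nil_divergent {P Q : ITree E R} (h : Trans P [] Q) (hQ : Divergent Q) :
    Divergent P := by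
  generalize ht : ([] : List E) = t at h
  induction h with
  | refl => exact hQ
  | sil _ ih => exact divergent_sil.2 (ih hQ ht)
  | vis => cases ht

theorem trans_ret {x : R} {t : List E} {P : ITree E R} :
    Trans (ret x) t P ↔ t = [] ∧ P = ret x := by
  constructor
  · intro h
    generalize hA : (ret x : ITree E R) = A at h
    cases h with
    | refl => exact ⟨rfl, rfl⟩
    | sil => exact absurd hA ret_ne_sil
    | vis => exact absurd hA ret_ne_vis
  · rintro ⟨rfl, rfl⟩
    exact .refl _

theorem Trans.of_sil {P Q : ITree E R} {t : List E} (h : Trans (ITree.sil P) t Q) :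
    (t = [] ∧ Q = ITree.sil P) ∨ Trans P t Q := by
  generalize hA : ITree.sil P = A at h
  cases h with
  | refl => exact Or.inl ⟨rfl, rfl⟩
  | sil h => exact Or.inr (sil_injective hA ▸ h)
  | vis => exact absurd hA sil_ne_vis

theorem trans_vis {F : E →. ITree E R} {t : List E} {P : ITree E R} :
    Trans (vis F) t P ↔
      (t = [] ∧ P = vis F) ∨ ∃ e t' Q, t = e :: t' ∧ Q ∈ F e ∧ Trans Q t' P := by
  constructor
  · intro h
    generalize hA : vis F = A at h
    cases h with
    | refl => exact Or.inl ⟨rfl, rfl⟩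
    | sil => exact absurd hA.symm sil_ne_vis
    | vis hQ h => exact Or.inr ⟨_, _, _, rfl, vis_injective hA ▸ hQ, h⟩
  · rintro (⟨rfl, rfl⟩ | ⟨e, t', Q, rfl, hQ, h⟩)
    · exact .refl _
    · exact .vis hQ h

/-! ### Recursive description of traces and divergences. -/

theorem mem_traces {P : ITree E R} {s : List (TickEvent E R)} :
    s ∈ traces P ↔ (∃ t x, s = t.map TickEvent.ev ++ [TickEvent.tick x] ∧ Trans P t (ret x)) ∨
      ∃ t P', s = t.map TickEvent.ev ∧ Trans P t P' := by
  constructor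
  · rintro ⟨-, P', ⟨t, x, hs, h, -⟩ | ⟨t, hs, h⟩⟩
    · exact Or.inl ⟨t, x, hs, h⟩
    · exact Or.inr ⟨t, P', hs, h⟩
  · intro h
    refine ⟨fun a _ => ?_, ?_⟩
    · cases a with
      | ev e => exact Or.inl ⟨e, rfl⟩
      | tick x => exact Or.inr ⟨x, rfl⟩
    · rcases h with ⟨t, x, hs, h⟩ | ⟨t, P', hs, h⟩
      · exact ⟨deadlock, Or.inl ⟨t, x, hs, h, rfl⟩⟩
      · exact ⟨P', Or.inr ⟨t, hs, h⟩⟩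

theorem nil_mem_traces (P : ITree E R) : [] ∈ traces P :=
  mem_traces.2 (Or.inr ⟨[], P, rfl, .refl P⟩)

theorem traces_sil (P : ITree E R) : traces (sil P) = traces P := by
  ext s
  rw [mem_traces, mem_traces]
  constructor
  · rintro (⟨t, x, rfl, h⟩ | ⟨t, P', rfl, h⟩)
    · rcases h.of_sil with ⟨-, h⟩ | h
      · exact absurd h ret_ne_sil
      · exact Or.inl ⟨t, x, rfl, h⟩
    · rcases h.of_sil with ⟨rfl, -⟩ | h
      · exact Or.inr ⟨[], P, rfl, .refl P⟩
      · exact Or.inr ⟨t, P', rfl, h⟩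
  · rintro (⟨t, x, rfl, h⟩ | ⟨t, P', rfl, h⟩)
    · exact Or.inl ⟨t, x, rfl, h.sil⟩
    · exact Or.inr ⟨t, P', rfl, h.sil⟩

theorem cons_mem_traces_ret {x : R} {a : TickEvent E R} {s : List (TickEvent E R)} :
    a :: s ∈ traces (ret x) ↔ a = .tick x ∧ s = [] := by
  rw [mem_traces]
  constructor
  · rintro (⟨t, y, hs, h⟩ | ⟨t, P', hs, h⟩)
    · obtain ⟨rfl, hy⟩ := trans_ret.1 h
      obtain rfl := ret_injective hy
      simpa using hs
    · obtain ⟨rfl, -⟩ := trans_ret.1 h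
      simp at hs
  · rintro ⟨rfl, rfl⟩
    exact Or.inl ⟨[], x, rfl, .refl _⟩

theorem cons_mem_traces_vis {F : E →. ITree E R} {a : TickEvent E R}
    {s : List (TickEvent E R)} :
    a :: s ∈ traces (vis F) ↔ ∃ e, a = .ev e ∧ ∃ Q ∈ F e, s ∈ traces Q := by
  constructor
  · intro h
    rcases mem_traces.1 h with ⟨t, x, hs, h⟩ | ⟨t, P', hs, h⟩
    · rcases trans_vis.1 h with ⟨-, hx⟩ | ⟨e, t', Q, rfl, hQ, h'⟩
      · exact absurd hx ret_ne_vis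
      · obtain ⟨rfl, rfl⟩ := List.cons.inj hs
        exact ⟨e, rfl, Q, hQ, mem_traces.2 (Or.inl ⟨t', x, rfl, h'⟩)⟩
    · rcases trans_vis.1 h with ⟨rfl, -⟩ | ⟨e, t', Q, rfl, hQ, h'⟩
      · simp at hs
      · obtain ⟨rfl, rfl⟩ := List.cons.inj hs
        exact ⟨e, rfl, Q, hQ, mem_traces.2 (Or.inr ⟨t', P', rfl, h'⟩)⟩
  · rintro ⟨e, rfl, Q, hQ, h⟩
    rcases mem_traces.1 h with ⟨t, x, rfl, h'⟩ | ⟨t, P', rfl, h'⟩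
    · exact mem_traces.2 (Or.inl ⟨e :: t, x, rfl, .vis hQ h'⟩)
    · exact mem_traces.2 (Or.inr ⟨e :: t, P', rfl, .vis hQ h'⟩)

theorem mem_divergences {P : ITree E R} {r : List (TickEvent E R)} :
    r ∈ divergences P ↔ ∃ (s t : List E) (Q : ITree E R),
      r = (s ++ t).map TickEvent.ev ∧ Trans P s Q ∧ Divergent Q := by
  constructor
  · rintro ⟨s, t, rfl, -, ht, Q, ⟨-, -, -, -, rfl⟩ | ⟨u, rfl, h⟩, hQ⟩
    -- A run ending in termination leads to `deadlock`, which is stable.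
    · exact absurd hQ (stable_vis _).not_divergent
    · obtain ⟨v, rfl⟩ : t ∈ Set.range (List.map TickEvent.ev) := by
        rw [Set.range_list_map]
        exact ht
      exact ⟨u, v, Q, List.map_append.symm, h, hQ⟩
  · rintro ⟨s, t, Q, rfl, h, hQ⟩
    have hmem (l : List E) : ∀ a ∈ l.map TickEvent.ev, a ∈ ordinaryEvents E R := by
      intro a ha
      obtain ⟨e, -, rfl⟩ := List.mem_map.1 ha
      exact ⟨e, rfl⟩
    exact ⟨s.map .ev, t.map .ev, List.map_append, hmem s, hmem t, Q, Or.inr ⟨s, rfl, h⟩, hQ⟩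

theorem nil_mem_divergences {P : ITree E R} : [] ∈ divergences P ↔ Divergent P := by
  rw [mem_divergences]
  constructor
  · rintro ⟨s, t, Q, hs, h, hQ⟩
    obtain ⟨rfl, -⟩ := List.append_eq_nil_iff.1 (List.map_eq_nil_iff.1 hs.symm)
    exact trans_nil_divergent h hQ
  · intro h
    exact ⟨[], [], P, rfl, .refl P, h⟩

theorem divergences_sil (P : ITree E R) : divergences (sil P) = divergences P := by
  ext r
  rw [mem_divergences, mem_divergences]
  constructor
  · rintro ⟨s, t, Q, rfl, h, hQ⟩
    rcases h.of_sil with ⟨rfl, rfl⟩ | h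
    · exact ⟨[], t, P, rfl, .refl P, divergent_sil.1 hQ⟩
    · exact ⟨s, t, Q, rfl, h, hQ⟩
  · rintro ⟨s, t, Q, rfl, h, hQ⟩
    exact ⟨s, t, Q, rfl, h.sil, hQ⟩

theorem cons_mem_divergences_vis {F : E →. ITree E R} {a : TickEvent E R}
    {r : List (TickEvent E R)} :
    a :: r ∈ divergences (vis F) ↔ ∃ e, a = .ev e ∧ ∃ Q ∈ F e, r ∈ divergences Q := by
  constructor
  · intro h
    obtain ⟨s, t, Q, hs, h, hQ⟩ := mem_divergences.1 h
    rcases trans_vis.1 h with ⟨-, rfl⟩ | ⟨e, t', P', rfl, hP', h'⟩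
    -- The run to the divergent tree is nonempty, so `a` comes from it and not from the arbitrary
    -- tail.
    · exact absurd hQ (stable_vis F).not_divergent
    · obtain ⟨rfl, rfl⟩ := List.cons.inj hs
      exact ⟨e, rfl, P', hP', mem_divergences.2 ⟨t', t, Q, rfl, h', hQ⟩⟩
  · rintro ⟨e, rfl, P', hP', h⟩
    obtain ⟨s, t, Q, rfl, h, hQ⟩ := mem_divergences.1 h
    exact mem_divergences.2 ⟨e :: s, t, Q, rfl, .vis hP' h, hQ⟩

/-! ### Weak bisimilarity preserves both sets. -/

theorem exists_mem_congr_of_dom_eq {F G : E →. ITree E R} {𝓡 : ITree E R → ITree E R → Prop}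
    (hdom : F.Dom = G.Dom) (hFG : ∀ e, ∀ P ∈ F e, ∀ Q ∈ G e, 𝓡 P Q) {p : ITree E R → Prop}
    (hp : ∀ P Q, 𝓡 P Q → (p P ↔ p Q)) (e : E) : (∃ P ∈ F e, p P) ↔ ∃ Q ∈ G e, p Q := by
  constructor
  · rintro ⟨P, hP, h⟩
    have he : e ∈ G.Dom := hdom ▸ (PFun.mem_dom F e).2 ⟨P, hP⟩
    obtain ⟨Q, hQ⟩ := (PFun.mem_dom G e).1 he
    exact ⟨Q, hQ, (hp P Q (hFG e P hP Q hQ)).1 h⟩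
  · rintro ⟨Q, hQ, h⟩
    have he : e ∈ F.Dom := hdom ▸ (PFun.mem_dom G e).2 ⟨Q, hQ⟩
    obtain ⟨P, hP⟩ := (PFun.mem_dom F e).1 he
    exact ⟨P, hP, (hp P Q (hFG e P hP Q hQ)).2 h⟩

/-- A set-valued invariant of trees that ignores silent events, and is determined on visible
choices by the values of the continuations, is invariant under weak bisimilarity. -/
theorem WeakBisim.eq_of_recursive {T : ITree E R → Set (List (TickEvent E R))}
    (T_sil : ∀ P, T (sil P) = T P)
    (T_nil : ∀ F G : E →. ITree E R, [] ∈ T (vis F) ↔ [] ∈ T (vis G))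
    (T_cons : ∀ (F : E →. ITree E R) a s,
      a :: s ∈ T (vis F) ↔ ∃ e, a = .ev e ∧ ∃ Q ∈ F e, s ∈ T Q)
    {P Q : ITree E R} (h : WeakBisim P Q) : T P = T Q := by
  obtain ⟨𝓡, h𝓡, hPQ⟩ := h
  ext s
  induction s generalizing P Q with
  | nil =>
    rcases h𝓡 P Q hPQ with ⟨rfl, rfl⟩ | h
    · rfl
    · clear hPQ
      induction h with
      | ret => rfl
      | sil_left _ ih => rwa [T_sil]
      | sil_right _ ih => rwa [T_sil]
      | vis => exact T_nil _ _
  | cons a s ih =>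
    rcases h𝓡 P Q hPQ with ⟨rfl, rfl⟩ | h
    · rfl
    -- The inner induction strips silent steps, and `𝓡` need not relate the stripped trees; it is
    -- available again only at continuations.
    · clear hPQ
      induction h with
      | ret => rfl
      | sil_left _ ih' => rwa [T_sil]
      | sil_right _ ih' => rwa [T_sil]
      | vis hdom hFG =>
        rw [T_cons, T_cons]
        exact exists_congr fun e => and_congr_right fun _ =>
          exists_mem_congr_of_dom_eq hdom hFG (fun _ _ h => ih h) e

theorem WeakBisim.traces_eq {P Q : ITree E R} (h : WeakBisim P Q) : traces P = traces Q :=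
  h.eq_of_recursive traces_sil
    (fun _ _ => iff_of_true (nil_mem_traces _) (nil_mem_traces _))
    (fun _ _ _ => cons_mem_traces_vis)

theorem WeakBisim.divergences_eq {P Q : ITree E R} (h : WeakBisim P Q) :
    divergences P = divergences Q :=
  h.eq_of_recursive divergences_sil
    (fun F G => iff_of_false
      (fun h => (stable_vis F).not_divergent (nil_mem_divergences.1 h))
      (fun h => (stable_vis G).not_divergent (nil_mem_divergences.1 h)))
    (fun _ _ _ => cons_mem_divergences_vis)

/-! ### Equality of both sets is a weak bisimulation. -/

theorem traces_iterate_sil (n : ℕ) (P : ITree E R) : traces (sil^[n] P) = traces P := by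
  induction n with
  | zero => rfl
  | succ n ih => rw [Function.iterate_succ_apply', traces_sil, ih]

theorem divergences_iterate_sil (n : ℕ) (P : ITree E R) :
    divergences (sil^[n] P) = divergences P := by
  induction n with
  | zero => rfl
  | succ n ih => rw [Function.iterate_succ_apply', divergences_sil, ih]

theorem WeakBisimStep.iterate_sil {𝓡 : ITree E R → ITree E R → Prop} {P Q : ITree E R}
    (h : WeakBisimStep 𝓡 P Q) (m n : ℕ) : WeakBisimStep 𝓡 (sil^[m] P) (sil^[n] Q) := by
  induction m with
  | zero =>
    induction n with
    | zero => exact h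
    | succ n ih =>
      rw [Function.iterate_succ_apply']
      exact ih.sil_right
  | succ m ih =>
    rw [Function.iterate_succ_apply']
    exact ih.sil_left

theorem traces_ret_ne_traces_vis (x : R) (F : E →. ITree E R) : traces (ret x) ≠ traces (vis F) := by
  intro h
  have hx : [TickEvent.tick x] ∈ traces (vis F) := h ▸ cons_mem_traces_ret.2 ⟨rfl, rfl⟩
  obtain ⟨e, he, -⟩ := cons_mem_traces_vis.1 hx
  cases he

theorem mem_dom_iff_mem_traces {F : E →. ITree E R} {e : E} :
    e ∈ F.Dom ↔ [TickEvent.ev e] ∈ traces (vis F) := by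
  rw [cons_mem_traces_vis, PFun.mem_dom]
  constructor
  · rintro ⟨Q, hQ⟩
    exact ⟨e, rfl, Q, hQ, nil_mem_traces Q⟩
  · rintro ⟨e', he, Q, hQ, -⟩
    obtain rfl := TickEvent.ev.inj he
    exact ⟨Q, hQ⟩

/-- Determinism enters here: `F e` has at most one value, so the traces of `P` can be read off from
those of the choice. -/
theorem mem_traces_of_mem {F : E →. ITree E R} {e : E} {P : ITree E R} (hP : P ∈ F e)
    {s : List (TickEvent E R)} : s ∈ traces P ↔ .ev e :: s ∈ traces (vis F) := by
  rw [cons_mem_traces_vis]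
  constructor
  · exact fun h => ⟨e, rfl, P, hP, h⟩
  · rintro ⟨e', he, Q, hQ, h⟩
    obtain rfl := TickEvent.ev.inj he
    exact Part.mem_unique hQ hP ▸ h

theorem mem_divergences_of_mem {F : E →. ITree E R} {e : E} {P : ITree E R} (hP : P ∈ F e)
    {s : List (TickEvent E R)} : s ∈ divergences P ↔ .ev e :: s ∈ divergences (vis F) := by
  rw [cons_mem_divergences_vis]
  constructor
  · exact fun h => ⟨e, rfl, P, hP, h⟩
  · rintro ⟨e', he, Q, hQ, h⟩
    obtain rfl := TickEvent.ev.inj he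
    exact Part.mem_unique hQ hP ▸ h

/-- Equality of traces and divergences. -/
def TraceDivergenceEq (P Q : ITree E R) : Prop :=
  traces P = traces Q ∧ divergences P = divergences Q

/-- The termination events tell returns from choices and determine the returned value; the one-event
traces determine the domain of a choice. -/
theorem TraceDivergenceEq.weakBisimStep_of_stable {P Q : ITree E R} (h : TraceDivergenceEq P Q)
    (hP : Stable P) (hQ : Stable Q) : WeakBisimStep TraceDivergenceEq P Q := by
  obtain ⟨ht, hd⟩ := h
  rcases hP.eq_ret_or_vis with ⟨x, rfl⟩ | ⟨F, rfl⟩ <;>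
    rcases hQ.eq_ret_or_vis with ⟨y, rfl⟩ | ⟨G, rfl⟩
  · have hx : [TickEvent.tick x] ∈ traces (ret y : ITree E R) :=
      ht ▸ cons_mem_traces_ret.2 ⟨rfl, rfl⟩
    obtain rfl := TickEvent.tick.inj (cons_mem_traces_ret.1 hx).1
    exact .ret x
  · exact absurd ht (traces_ret_ne_traces_vis x G)
  · exact absurd ht.symm (traces_ret_ne_traces_vis y F)
  · refine .vis ?_ fun e P hP Q hQ => ⟨?_, ?_⟩
    · ext e
      rw [mem_dom_iff_mem_traces, mem_dom_iff_mem_traces, ht]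
    · ext s
      rw [mem_traces_of_mem hP, mem_traces_of_mem hQ, ht]
    · ext s
      rw [mem_divergences_of_mem hP, mem_divergences_of_mem hQ, hd]

theorem TraceDivergenceEq.weakBisim {P Q : ITree E R} (h : TraceDivergenceEq P Q) :
    WeakBisim P Q := by
  refine ⟨TraceDivergenceEq, fun P Q h => ?_, h⟩
  -- Traces alone cannot separate `div` from `deadlock`; divergences are needed here.
  have hdiv : Divergent P ↔ Divergent Q := by
    rw [← nil_mem_divergences, ← nil_mem_divergences, h.2]
  by_cases hP : Divergent P
  · exact Or.inl ⟨hP.eq_div, (hdiv.1 hP).eq_div⟩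
  · obtain ⟨m, P', rfl, hP'⟩ := not_not.1 hP
    obtain ⟨n, Q', rfl, hQ'⟩ := not_not.1 (mt hdiv.2 hP)
    have h' : TraceDivergenceEq P' Q' := by
      simpa only [TraceDivergenceEq, traces_iterate_sil, divergences_iterate_sil] using h
    exact Or.inr ((h'.weakBisimStep_of_stable hP' hQ').iterate_sil m n)

end ITree

theorem mainTheorem4 {E : Type*} {R : Type*} (P Q : ITree E R) :
    ITree.WeakBisim P Q ↔
      ITree.traces P = ITree.traces Q ∧ ITree.divergences P = ITree.divergences Q :=
  ⟨fun h => ⟨h.traces_eq, h.divergences_eq⟩, fun h => ITree.TraceDivergenceEq.weakBisim h⟩
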